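/- Write $X\subseteq^* Y$ if $X\setminus Y$ is finite. An infinite set $C\subseteq\omega$ is cohesive if for every c.e. set $W$, either $W\cap C$ or $\overline{W}\cap C$ is finite. A partial injection structure $(A,f)$ is a set $A$ with a partial function $f:A\to A$ such that $f(x)\neq f(y)$ whenever $x\neq y$ are in $\mathrm{dom}(f)$; it is identified with the relational structure $\mathcal{A}=(A,G_f)$, where $G_f=\{(x,y): x\in\mathrm{dom}(f),\ f(x)=y\}$. It is a computable partial injection structure if $A\subseteq\omega$ is a computable set, $f$ is partial computable, and $G_f$ is a computable relation. The orbit of $a$ is $\{b:\exists n\in\omega\,(f^n(a)=b\text{ or }f^n(b)=a)\}$. For $k\ge 1$, a $k$-cycle is a set of $k$ distinct elements $x_1,\dots,x_k$ with $f(x_i)=x_{i+1}$ for $i<k$ and $f(x_k)=x_1$; a $k$-chain is a set of $k$ distinct elements $x_1,\dots,x_k$ with $x_1\notin\mathrm{ran}(f)$, $f(x_i)=x_{i+1}$ for $i<k$, and $x_k\notin\mathrm{dom}(f)$. The cycle character (resp. finite chain character) is the set of pairs $\langle k,n\rangle$ with $k,n\geq 1$ such that there are at least $n$ many $k$-cycles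 (resp. $k$-chains); it is bounded if there is an upper bound on the $k$ occurring in it. For a computable structure $\mathcal{A}=(A,G)$ with one binary relation and a cohesive set $C$, the cohesive power $\Pi_C\mathcal{A}$ has as domain the set of partial computable functions $\psi:\omega\to A$ with $C\subseteq^*\mathrm{dom}(\psi)$, modulo $\psi=_C\varphi$ iff $C\subseteq^*\{i:\psi(i)\downarrow=\varphi(i)\downarrow\}$; its relation holds of $([\psi],[\varphi])$ iff $C\subseteq^*\{i:\psi(i)\downarrow,\ \varphi(i)\downarrow,\ G(\psi(i),\varphi(i))\}$. Theorem. Let $\mathcal{A}=(A,f)$ be a computable partial injection structure and let $C$ be a cohesive set. (1) $\Pi_C\mathcal{A}$ is a partial injection structure (its binary relation is the graph of a partial injection), and it has the same cycle character and the same finite chain character as $\mathcal{A}$. (2) If the cycle character and the finite chain character of $\mathcal{A}$ are both bounded and $\mathcal{A}$ has no infinite orbits, then $\mathcal{A}\cong\Pi_C\mathcal{A}$ as relational structures. -/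

import Mathlib

universe u

/-- `X ⊆* Y`: inclusion up to finitely many elements. -/
def AlmostSubset (X Y : Set ℕ) : Prop := (X \ Y).Finite

/-- An infinite set of natural numbers that is not split by any c.e. set. -/
def IsCohesive (C : Set ℕ) : Prop :=
  C.Infinite ∧
    ∀ W : Set ℕ, REPred (fun n => n ∈ W) → (W ∩ C).Finite ∨ (Wᶜ ∩ C).Finite

theorem AlmostSubset.mono {X Y Z : Set ℕ} (h : AlmostSubset X Y) (hYZ : Y ⊆ Z) :
    AlmostSubset X Z :=
  Set.Finite.subset h (Set.sdiff_subset_sdiff_right hYZ)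

theorem AlmostSubset.inter {X Y Z : Set ℕ} (hY : AlmostSubset X Y) (hZ : AlmostSubset X Z) :
    AlmostSubset X (Y ∩ Z) := by
  unfold AlmostSubset at *
  rw [Set.sdiff_inter]
  exact hY.union hZ

/-! ### Cohesive powers of structures with one binary relation -/

/-- The partial computable functions `ψ` from `ℕ` to `A` with `C ⊆* dom ψ`. -/
structure CohesiveSeq (A C : Set ℕ) where
  toFun : ℕ →. ℕ
  partrec : Partrec toFun
  mem_carrier : ∀ i, ∀ a ∈ toFun i, a ∈ A
  almost_dom : AlmostSubset C {i | (toFun i).Dom}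

namespace CohesiveSeq

/-- `ψ =_C φ`: the values `ψ i` and `φ i` exist and agree for almost all `i` in `C`. -/
def Equal {A C : Set ℕ} (ψ φ : CohesiveSeq A C) : Prop :=
  AlmostSubset C {i | ∃ a, a ∈ ψ.toFun i ∧ a ∈ φ.toFun i}

/-- The relation `R` holds of `ψ i` and `φ i` for almost all `i` in `C`. -/
def Holds {A C : Set ℕ} (R : A → A → Prop) (ψ φ : CohesiveSeq A C) : Prop :=
  AlmostSubset C
    {i | ∃ (a b : ℕ) (ha : a ∈ A) (hb : b ∈ A),
      a ∈ ψ.toFun i ∧ b ∈ φ.toFun i ∧ R ⟨a, ha⟩ ⟨b, hb⟩}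

theorem Equal.refl {A C : Set ℕ} (ψ : CohesiveSeq A C) : Equal ψ ψ :=
  ψ.almost_dom.mono (fun _ hi => ⟨_, Part.get_mem hi, Part.get_mem hi⟩)

theorem Equal.symm {A C : Set ℕ} {ψ φ : CohesiveSeq A C} (h : Equal ψ φ) : Equal φ ψ :=
  AlmostSubset.mono h (fun _ ⟨a, h₁, h₂⟩ => ⟨a, h₂, h₁⟩)

theorem Equal.trans {A C : Set ℕ} {ψ φ θ : CohesiveSeq A C} (h : Equal ψ φ) (h' : Equal φ θ) :
    Equal ψ θ := by
  refine AlmostSubset.mono (AlmostSubset.inter h h') ?_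
  rintro i ⟨⟨a, h₁, h₂⟩, ⟨b, h₃, h₄⟩⟩
  obtain rfl := Part.mem_unique h₂ h₃
  exact ⟨a, h₁, h₄⟩

instance setoid (A C : Set ℕ) : Setoid (CohesiveSeq A C) where
  r := Equal
  iseqv := ⟨Equal.refl, Equal.symm, Equal.trans⟩

theorem Holds.congr {A C : Set ℕ} {R : A → A → Prop} {ψ φ ψ' φ' : CohesiveSeq A C}
    (h₁ : Equal ψ ψ') (h₂ : Equal φ φ') (h : Holds R ψ φ) : Holds R ψ' φ' := by
  refine AlmostSubset.mono (AlmostSubset.inter h (AlmostSubset.inter h₁ h₂)) ?_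
  rintro i ⟨⟨a, b, ha, hb, ha', hb', hR⟩, ⟨c, hc, hc'⟩, ⟨d, hd, hd'⟩⟩
  obtain rfl := Part.mem_unique ha' hc
  obtain rfl := Part.mem_unique hb' hd
  exact ⟨a, b, ha, hb, hc', hd', hR⟩

end CohesiveSeq

/-- The domain of the cohesive power over `C` of a structure with domain `A`. -/
def CohesivePower (A C : Set ℕ) : Type := Quotient (CohesiveSeq.setoid A C)

/-- The interpretation in the cohesive power over `C` of a binary relation `R` on `A`:
it holds of `[ψ]` and `[φ]` iff `C ⊆* {i | R (ψ i) (φ i)}`. -/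
def CohesivePower.rel (A C : Set ℕ) (R : A → A → Prop) :
    CohesivePower A C → CohesivePower A C → Prop :=
  Quotient.lift₂ (CohesiveSeq.Holds R) (fun _ _ _ _ h₁ h₂ =>
    propext ⟨CohesiveSeq.Holds.congr h₁ h₂, CohesiveSeq.Holds.congr h₁.symm h₂.symm⟩)

/-! ### Partial injection structures -/

/-- A partial injection structure with domain `X`. -/
structure PartialInjection (X : Type u) where
  toFun : X →. X
  inj : ∀ x y z, z ∈ toFun x → z ∈ toFun y → x = y

namespace PartialInjection

variable {X : Type u}

/-- The graph `G_f`; the relational structure is `(X, G_f)`. -/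
def Graph (f : PartialInjection X) (x y : X) : Prop := y ∈ f.toFun x

/-- The partial function `f^n`. -/
def iter (f : PartialInjection X) : ℕ → X → Part X
  | 0, x => Part.some x
  | n + 1, x => (f.iter n x).bind f.toFun

def orbit (f : PartialInjection X) (a : X) : Set X :=
  {b | ∃ n : ℕ, b ∈ f.iter n a ∨ a ∈ f.iter n b}

/-- `S` is a `k`-cycle: `S = {x 0, …, x (k - 1)}` with these `k ≥ 1` elements distinct,
`f (x i) = x (i + 1)` for `i + 1 < k`, and `f (x (k - 1)) = x 0`. -/
def IsCycle (f : PartialInjection X) (k : ℕ) (S : Set X) : Prop :=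
  1 ≤ k ∧ ∃ x : ℕ → X, Set.InjOn x (Set.Iio k) ∧ S = x '' Set.Iio k ∧
    ∀ i < k, x ((i + 1) % k) ∈ f.toFun (x i)

/-- `S` is a `k`-chain: `S = {x 0, …, x (k - 1)}` with these `k ≥ 1` elements distinct,
`x 0` not in the range of `f`, `f (x i) = x (i + 1)` for `i + 1 < k`, and `x (k - 1)` not in
the domain of `f`. -/
def IsChain (f : PartialInjection X) (k : ℕ) (S : Set X) : Prop :=
  1 ≤ k ∧ ∃ x : ℕ → X, Set.InjOn x (Set.Iio k) ∧ S = x '' Set.Iio k ∧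
    (∀ y, x 0 ∉ f.toFun y) ∧
    (∀ i, i + 1 < k → x (i + 1) ∈ f.toFun (x i)) ∧
    ¬ (f.toFun (x (k - 1))).Dom

/-- The pairs `(k, n)` of positive integers such that there are at least `n` many `k`-cycles. -/
def cycleCharacter (f : PartialInjection X) : Set (ℕ × ℕ) :=
  {p | 1 ≤ p.1 ∧ 1 ≤ p.2 ∧ (p.2 : ℕ∞) ≤ Set.encard {S : Set X | f.IsCycle p.1 S}}

/-- The pairs `(k, n)` of positive integers such that there are at least `n` many `k`-chains. -/
def chainCharacter (f : PartialInjection X) : Set (ℕ × ℕ) :=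
  {p | 1 ≤ p.1 ∧ 1 ≤ p.2 ∧ (p.2 : ℕ∞) ≤ Set.encard {S : Set X | f.IsChain p.1 S}}

/-- The partial function on `ℕ` with the same graph as the partial function `f` on `A ⊆ ℕ`. -/
def natFun {A : Set ℕ} (f : PartialInjection A) : ℕ →. ℕ := fun n =>
  ⟨∃ h : n ∈ A, (f.toFun ⟨n, h⟩).Dom, fun h => (f.toFun ⟨n, h.1⟩).get h.2⟩

/-- `(A, f)` is a computable partial injection structure: the domain `A` is a computable set,
`f` is a partial computable function, and the graph `G_f` is a computable relation. -/
def IsComputable {A : Set ℕ} (f : PartialInjection A) : Prop :=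
  ComputablePred (fun n : ℕ => n ∈ A) ∧
  Partrec f.natFun ∧
  ComputablePred (fun p : ℕ × ℕ => ∃ (h₁ : p.1 ∈ A) (h₂ : p.2 ∈ A),
    f.Graph ⟨p.1, h₁⟩ ⟨p.2, h₂⟩)

end PartialInjection

/-- A character is bounded if there is an upper bound on the sizes `k` occurring in it. -/
def BoundedCharacter (χ : Set (ℕ × ℕ)) : Prop := ∃ M : ℕ, ∀ p ∈ χ, p.1 ≤ M

/-! ### Almost inclusion and cohesive sets -/

/-! A `k`-cycle or `k`-chain is a finite configuration given by edges, inequalities and, for chains,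
a first element outside the range and a last one outside the domain. A map respecting these
conditions on finite sets (`IsLocalEmbedding`) carries components to components, and distinct ones
to distinct ones.

Constant sequences embed the structure in its power. Conversely, given finitely many elements of the
power, each condition holds of their values at almost all `i` in `C`: edges by definition, negative
conditions by cohesiveness. Indeed agreement of two values, or a value lying in the domain or range,
is c.e. in `i`; if it held almost everywhere, the two elements would be equal, or an image or
preimage would exist in the power. So some `i` in `C` serves all conditions at once, and evaluation
at `i` is a local embedding (`exists_isLocalEmbedding`). Hence the component counts agree.

For (2), components of size at most `M` cover the structure, so it has no path with `M + 1` distinct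
vertices. By evaluation neither has the power, so components cover it too. Both are countable, and
component counts then determine the isomorphism type. -/

theorem AlmostSubset.exists_mem {C W : Set ℕ} (hC : C.Infinite) (h : AlmostSubset C W) :
    ∃ i ∈ C, i ∈ W := by
  by_contra! hn
  exact hC (Set.Finite.subset h fun i hi => ⟨hi, hn i hi⟩)

theorem AlmostSubset.of_subset {C W : Set ℕ} (h : C ⊆ W) : AlmostSubset C W := by
  unfold AlmostSubset
  rw [Set.sdiff_eq_empty.2 h]
  exact Set.finite_empty

theorem AlmostSubset.forall_mem_finite {ι : Type*} {C : Set ℕ} {F : Set ι} (hF : F.Finite)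
    {W : ι → Set ℕ} (h : ∀ a ∈ F, AlmostSubset C (W a)) :
    AlmostSubset C {i | ∀ a ∈ F, i ∈ W a} := by
  refine Set.Finite.subset (hF.biUnion h) ?_
  rintro i ⟨hi, hn⟩
  simp only [Set.mem_ofPred_eq, not_forall] at hn
  obtain ⟨a, ha, hia⟩ := hn
  exact Set.mem_biUnion ha ⟨hi, hia⟩

theorem IsCohesive.almostSubset_or_compl {C W : Set ℕ} (hC : IsCohesive C)
    (hW : REPred (fun n => n ∈ W)) : AlmostSubset C W ∨ AlmostSubset C Wᶜ := by
  unfold AlmostSubset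
  rcases hC.2 W hW with h | h
  · right
    rwa [Set.sdiff_compl, Set.inter_comm]
  · left
    rwa [Set.sdiff_eq, Set.inter_comm]

/-! ### Graphs of partial injections -/

namespace PartialInjection

variable {X Y : Type u}

theorem Graph.right_unique {f : PartialInjection X} {x y z : X} (h : f.Graph x y)
    (h' : f.Graph x z) : y = z :=
  Part.mem_unique h h'

theorem Graph.left_unique {f : PartialInjection X} {x y z : X} (h : f.Graph x z)
    (h' : f.Graph y z) : x = y :=
  f.inj x y z h h'

/-- The partial injection whose graph is a given functional and injective relation. -/
noncomputable def ofRel (R : X → X → Prop)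
    (hl : ∀ x y z, R x z → R y z → x = y) : PartialInjection X where
  toFun x := ⟨∃ y, R x y, fun h => h.choose⟩
  inj x y z := by
    rintro ⟨hx, rfl⟩ ⟨hy, h⟩
    have hxy : hy.choose = hx.choose := h
    exact hl _ _ _ hx.choose_spec (hxy ▸ hy.choose_spec)

theorem graph_ofRel (R : X → X → Prop) (hr : ∀ x y z, R x y → R x z → y = z)
    (hl : ∀ x y z, R x z → R y z → x = y) : (ofRel R hl).Graph = R := by
  funext x y
  refine propext ⟨?_, fun h => ⟨⟨y, h⟩, hr _ _ _ (Exists.choose_spec (p := R x) ⟨y, h⟩) h⟩⟩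
  rintro ⟨hx, rfl⟩
  exact hx.choose_spec

theorem not_dom_iff {f : PartialInjection X} {x : X} :
    ¬ (f.toFun x).Dom ↔ ∀ y, ¬ f.Graph x y :=
  ⟨fun h _ hy => h (Part.dom_iff_mem.2 ⟨_, hy⟩), fun h hd => h _ (Part.get_mem hd)⟩

/-! ### Cycles and chains -/

/-- The condition on an enumeration of a cycle (`true`) or of a chain (`false`) of size `k`. -/
def Enumerates (f : PartialInjection X) : Bool → ℕ → (ℕ → X) → Prop
  | true, k, x => ∀ i < k, x ((i + 1) % k) ∈ f.toFun (x i)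
  | false, k, x => (∀ y, x 0 ∉ f.toFun y) ∧
      (∀ i, i + 1 < k → x (i + 1) ∈ f.toFun (x i)) ∧ ¬ (f.toFun (x (k - 1))).Dom

/-- `S` is a `k`-cycle (for `true`) or a `k`-chain (for `false`). -/
def IsComponent (f : PartialInjection X) (b : Bool) (k : ℕ) (S : Set X) : Prop :=
  1 ≤ k ∧ ∃ x : ℕ → X, Set.InjOn x (Set.Iio k) ∧ S = x '' Set.Iio k ∧ f.Enumerates b k x

/-- `j` is the position after `i` in a cycle (`true`) or chain (`false`) of size `k`. -/
def IsNext (b : Bool) (k i j : ℕ) : Prop := j = i + 1 ∨ b = true ∧ i + 1 = k ∧ j = 0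

/-- Functionality rules out edges other than the listed ones, and the last element of a chain has
none. -/
theorem Enumerates.graph_iff {f : PartialInjection X} {b : Bool} {k : ℕ} {x : ℕ → X}
    (h : f.Enumerates b k x) {i : ℕ} (hi : i < k) {y : X} :
    f.Graph (x i) y ↔ ∃ j < k, IsNext b k i j ∧ y = x j := by
  have key : ∀ j < k, IsNext b k i j → f.Graph (x i) (x j) := by
    rintro j hj (rfl | ⟨rfl, rfl, rfl⟩)
    · cases b
      · exact h.2.1 i hj
      · have := h i hi
        rwa [Nat.mod_eq_of_lt hj] at this
    · have := h i hi
      rwa [Nat.mod_self] at this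
  constructor
  · intro hy
    suffices ∃ j < k, IsNext b k i j by
      obtain ⟨j, hj, hn⟩ := this
      exact ⟨j, hj, hn, hy.right_unique (key j hj hn)⟩
    by_cases hik : i + 1 < k
    · exact ⟨i + 1, hik, Or.inl rfl⟩
    · cases b
      · obtain rfl : i = k - 1 := by omega
        exact absurd hy (not_dom_iff.1 h.2.2 y)
      · exact ⟨0, by omega, Or.inr ⟨rfl, by omega, rfl⟩⟩
  · rintro ⟨j, hj, hn, rfl⟩
    exact key j hj hn

theorem Enumerates.exists_of_graph {f : PartialInjection X} {b : Bool} {k : ℕ} {x : ℕ → X}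
    (h : f.Enumerates b k x) {i : ℕ} (hi : i < k) {y : X} (hy : f.Graph y (x i)) :
    ∃ j < k, y = x j := by
  suffices ∃ j < k, IsNext b k j i by
    obtain ⟨j, hj, hn⟩ := this
    exact ⟨j, hj, hy.left_unique ((h.graph_iff hj).2 ⟨i, hi, hn, rfl⟩)⟩
  rcases Nat.eq_zero_or_pos i with rfl | hpos
  · cases b
    · exact absurd hy (h.1 y)
    · exact ⟨k - 1, by omega, Or.inr ⟨rfl, by omega, rfl⟩⟩
  · exact ⟨i - 1, by omega, Or.inl (by omega)⟩

namespace IsComponent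

variable {f : PartialInjection X} {b b' : Bool} {k k' : ℕ} {S S' : Set X}

theorem mem_of_graph (h : f.IsComponent b k S) {x y : X} (hx : x ∈ S) (hxy : f.Graph x y) :
    y ∈ S := by
  obtain ⟨-, e, -, rfl, he⟩ := h
  obtain ⟨i, hi, rfl⟩ := hx
  obtain ⟨j, hj, -, rfl⟩ := (he.graph_iff hi).1 hxy
  exact ⟨j, hj, rfl⟩

theorem mem_of_graph' (h : f.IsComponent b k S) {x y : X} (hx : x ∈ S) (hxy : f.Graph y x) :
    y ∈ S := by
  obtain ⟨-, e, -, rfl, he⟩ := h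
  obtain ⟨i, hi, rfl⟩ := hx
  obtain ⟨j, hj, rfl⟩ := he.exists_of_graph hi hxy
  exact ⟨j, hj, rfl⟩

/-- Both sets are closed under edges in either direction: walk back from `a` to the first element of
`S`, then forward through `S`, never leaving `S'`. -/
theorem subset_of_mem (h : f.IsComponent b k S) (h' : f.IsComponent b' k' S') {a : X}
    (ha : a ∈ S) (ha' : a ∈ S') : S ⊆ S' := by
  obtain ⟨-, e, -, rfl, he⟩ := h
  obtain ⟨i, hi, rfl⟩ := ha
  have hstep : ∀ n, n + 1 < k → f.Graph (e n) (e (n + 1)) := fun n hn =>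
    (he.graph_iff (by omega)).2 ⟨n + 1, hn, Or.inl rfl, rfl⟩
  have h0 : e 0 ∈ S' := by
    have hdown : ∀ n < k, e n ∈ S' → e 0 ∈ S' := by
      intro n
      induction n with
      | zero => exact fun _ h => h
      | succ n ih => exact fun hn hm => ih (by omega) (h'.mem_of_graph' hm (hstep n hn))
    exact hdown i hi ha'
  rintro _ ⟨n, hn, rfl⟩
  induction n with
  | zero => exact h0
  | succ n ih => exact h'.mem_of_graph (ih (Nat.lt_of_succ_lt hn)) (hstep n hn)

theorem eq_of_mem (h : f.IsComponent b k S) (h' : f.IsComponent b' k' S') {a : X}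
    (ha : a ∈ S) (ha' : a ∈ S') : S = S' :=
  (h.subset_of_mem h' ha ha').antisymm (h'.subset_of_mem h ha' ha)

theorem ncard_eq (h : f.IsComponent b k S) : S.ncard = k := by
  obtain ⟨-, e, hinj, rfl, -⟩ := h
  rw [hinj.ncard_image]
  simp [Set.ncard_eq_toFinset_card']

theorem finite (h : f.IsComponent b k S) : S.Finite := by
  obtain ⟨-, e, -, rfl, -⟩ := h
  exact (Set.finite_Iio k).image e

/-- The set alone reveals its kind: the first element of a chain has no preimage. This keeps the
pieces of the normal form apart. -/
theorem true_iff (h : f.IsComponent b k S) : b = true ↔ ∀ x ∈ S, ∃ y, f.Graph y x := by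
  obtain ⟨hk, e, -, rfl, he⟩ := h
  constructor
  · rintro rfl _ ⟨i, hi, rfl⟩
    have hi : i < k := hi
    rcases Nat.eq_zero_or_pos i with rfl | hpos
    · exact ⟨e (k - 1), (he.graph_iff (by omega)).2
        ⟨0, hk, Or.inr ⟨rfl, by omega, rfl⟩, rfl⟩⟩
    · exact ⟨e (i - 1), (he.graph_iff (by omega)).2 ⟨i, hi, Or.inl (by omega), rfl⟩⟩
  · intro hall
    cases b
    · obtain ⟨y, hy⟩ := hall _ ⟨0, hk, rfl⟩
      exact absurd hy (he.1 y)
    · rfl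

end IsComponent

/-! ### Local embeddings -/

/-- `e` is injective on `F`, preserves the graph on `F`, and sends elements of `F` outside the
range (domain) of `f` to elements outside the range (domain) of `g`. -/
structure IsLocalEmbedding (f : PartialInjection X) (g : PartialInjection Y) (e : X → Y)
    (F : Set X) : Prop where
  injOn : Set.InjOn e F
  map_graph : ∀ x ∈ F, ∀ y ∈ F, f.Graph x y → g.Graph (e x) (e y)
  map_not_range : ∀ x ∈ F, (∀ y, ¬ f.Graph y x) → ∀ y, ¬ g.Graph y (e x)
  map_not_dom : ∀ x ∈ F, (∀ y, ¬ f.Graph x y) → ∀ y, ¬ g.Graph (e x) y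

theorem IsComponent.image {f : PartialInjection X} {g : PartialInjection Y} {e : X → Y}
    {F : Set X} (he : IsLocalEmbedding f g e F) {b : Bool} {k : ℕ} {S : Set X}
    (h : f.IsComponent b k S) (hS : S ⊆ F) : g.IsComponent b k (e '' S) := by
  obtain ⟨hk, x, hinj, rfl, hx⟩ := h
  have hF : ∀ i < k, x i ∈ F := fun i hi => hS ⟨i, hi, rfl⟩
  refine ⟨hk, e ∘ x, he.injOn.comp hinj hF, by rw [Set.image_comp], ?_⟩
  cases b
  · exact ⟨he.map_not_range _ (hF 0 hk) hx.1,
      fun i hi => he.map_graph _ (hF i (by omega)) _ (hF _ hi) (hx.2.1 i hi),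
      not_dom_iff.2 (he.map_not_dom _ (hF _ (by omega)) (not_dom_iff.1 hx.2.2))⟩
  · exact fun i hi => he.map_graph _ (hF i hi) _ (hF _ (Nat.mod_lt _ hk)) (hx i hi)

/-- If every finite part of `f` embeds locally in `g`, then `g` has at least as many cycles and
chains of each size as `f`. -/
theorem le_encard_isComponent {f : PartialInjection X} {g : PartialInjection Y}
    (h : ∀ F : Set X, F.Finite → ∃ e : X → Y, IsLocalEmbedding f g e F) (b : Bool) (k : ℕ) :
    Set.encard {S | f.IsComponent b k S} ≤ Set.encard {S | g.IsComponent b k S} := by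
  -- Testing against finite `n` means transporting only finitely many components, even when there
  -- are infinitely many.
  refine ENat.forall_natCast_le_iff_le.1 fun n hn => ?_
  obtain ⟨T, hT, hTn⟩ := Set.exists_subset_encard_eq hn
  have hTfin : T.Finite := Set.finite_of_encard_eq_coe hTn
  obtain ⟨e, he⟩ := h (⋃₀ T) (hTfin.sUnion fun S hS => (hT hS).finite)
  rw [← hTn, ← Set.InjOn.encard_image (f := fun S => e '' S) (s := T)]
  · refine Set.encard_le_encard ?_
    rintro _ ⟨S, hS, rfl⟩
    exact (hT hS).image he (Set.subset_sUnion_of_mem hS)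
  · intro S hS S' hS' heq
    exact (he.injOn.image_eq_image_iff (Set.subset_sUnion_of_mem hS)
      (Set.subset_sUnion_of_mem hS')).1 heq

theorem characters_eq {f : PartialInjection X} {g : PartialInjection Y}
    (h : ∀ b k, Set.encard {S | f.IsComponent b k S} = Set.encard {S | g.IsComponent b k S}) :
    f.cycleCharacter = g.cycleCharacter ∧ f.chainCharacter = g.chainCharacter := by
  constructor
  · ext ⟨k, n⟩
    have := h true k
    simp only [IsComponent, Enumerates] at this
    simp only [cycleCharacter, IsCycle, Set.mem_ofPred_eq, this]
  · ext ⟨k, n⟩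
    have := h false k
    simp only [IsComponent, Enumerates] at this
    simp only [chainCharacter, IsChain, Set.mem_ofPred_eq, this]

/-! ### Paths, and the decomposition into cycles and chains -/

/-- `p 0, …, p n` is a path in the graph of `f`. -/
def IsPath (f : PartialInjection X) (n : ℕ) (p : ℕ → X) : Prop :=
  ∀ i < n, f.Graph (p i) (p (i + 1))

theorem exists_isPath_of_transGen {f : PartialInjection X} {a b : X}
    (h : Relation.TransGen f.Graph a b) :
    ∃ n p, 1 ≤ n ∧ f.IsPath n p ∧ p 0 = a ∧ p n = b := by
  induction h with
  | single h => exact ⟨1, fun i => if i = 0 then a else _, le_rfl, by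
      intro i hi
      obtain rfl : i = 0 := by omega
      simpa using h, by simp, by simp⟩
  | @tail b c _ hbc ih =>
    obtain ⟨n, p, hn, hp, h0, rfl⟩ := ih
    refine ⟨n + 1, fun i => if i ≤ n then p i else c, by omega, fun i hi => ?_, by simpa, by simp⟩
    rcases Nat.lt_succ_iff_lt_or_eq.1 hi with h | rfl
    · simpa [h.le, Nat.succ_le_of_lt h] using hp i h
    · simpa using hbc

theorem IsPath.transGen {f : PartialInjection X} {n : ℕ} {p : ℕ → X} (hp : f.IsPath n p)
    {i j : ℕ} (hij : i < j) (hj : j ≤ n) : Relation.TransGen f.Graph (p i) (p j) := by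
  induction j, hij using Nat.le_induction with
  | base => exact .single (hp i hj)
  | succ j hij ih => exact (ih (by omega)).tail (hp j hj)

/-- Lying on a cycle passes forward along an edge by functionality and backward by injectivity. -/
theorem transGen_self_iff_of_graph {f : PartialInjection X} {a b : X} (h : f.Graph a b) :
    Relation.TransGen f.Graph a a ↔ Relation.TransGen f.Graph b b := by
  constructor
  · intro ha
    obtain ⟨c, hac, hca⟩ := Relation.TransGen.head'_iff.1 ha
    obtain rfl := h.right_unique hac
    exact Relation.TransGen.tail' hca h
  · intro hb
    obtain ⟨c, hbc, hcb⟩ := Relation.TransGen.tail'_iff.1 hb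
    obtain rfl := h.left_unique hcb
    exact Relation.TransGen.head' h hbc

theorem IsPath.transGen_self_iff {f : PartialInjection X} {n : ℕ} {p : ℕ → X}
    (hp : f.IsPath n p) {i : ℕ} (hi : i ≤ n) :
    Relation.TransGen f.Graph (p 0) (p 0) ↔ Relation.TransGen f.Graph (p i) (p i) := by
  induction i with
  | zero => rfl
  | succ i ih => exact (ih (by omega)).trans (transGen_self_iff_of_graph (hp i hi))

/-- A repeated vertex lies on a cycle, and then so does every vertex of the path. -/
theorem IsPath.injOn_of_not_transGen {f : PartialInjection X} {n : ℕ} {p : ℕ → X}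
    (hp : f.IsPath n p) {t : ℕ} (ht : t ≤ n) (hx : ¬ Relation.TransGen f.Graph (p t) (p t)) :
    Set.InjOn p (Set.Iic n) := by
  have key : ∀ i j, i < j → j ≤ n → p i ≠ p j := by
    intro i j hij hj heq
    have h := hp.transGen hij hj
    rw [← heq, ← hp.transGen_self_iff (by omega), hp.transGen_self_iff ht] at h
    exact hx h
  intro i hi j hj heq
  rcases lt_trichotomy i j with h | h | h
  · exact absurd heq (key i j h hj)
  · exact h
  · exact absurd heq.symm (key j i h hi)

theorem IsPath.eq_sub {f : PartialInjection X} {n : ℕ} {p : ℕ → X} (hp : f.IsPath n p)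
    {i j : ℕ} (hij : i ≤ j) (hj : j ≤ n) (h : p i = p j) : p 0 = p (j - i) := by
  induction i generalizing j with
  | zero => exact h
  | succ i ih =>
    obtain ⟨j, rfl⟩ : ∃ m, j = m + 1 := ⟨j - 1, by omega⟩
    have h₁ := hp i (by omega)
    rw [h] at h₁
    rw [ih (by omega) (by omega) (h₁.left_unique (hp j (by omega)))]
    congr 1
    omega

/-- A shortest closed walk of positive length from `x` is a cycle: injectivity pulls a repetition
back to the start (`IsPath.eq_sub`), giving a shorter closed walk. -/
theorem exists_isComponent_of_transGen {f : PartialInjection X} {x : X}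
    (h : Relation.TransGen f.Graph x x) : ∃ b k S, f.IsComponent b k S ∧ x ∈ S := by
  classical
  have hex : ∃ n, 1 ≤ n ∧ ∃ p, f.IsPath n p ∧ p 0 = x ∧ p n = x := by
    obtain ⟨n, p, hn, hp⟩ := exists_isPath_of_transGen h
    exact ⟨n, hn, p, hp⟩
  obtain ⟨hk, p, hp, h0, hpk⟩ := Nat.find_spec hex
  have hmin := fun m hm => Nat.find_min hex (m := m) hm
  set k := Nat.find hex
  have key : ∀ i j, i < j → j < k → p i ≠ p j := by
    intro i j hij hj heq
    exact hmin (j - i) (by omega) ⟨by omega, p, fun m hm => hp m (by omega), h0,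
      (hp.eq_sub hij.le hj.le heq).symm.trans h0⟩
  refine ⟨true, k, p '' Set.Iio k, ⟨hk, p, ?_, rfl, fun i hi => ?_⟩, 0, hk, h0⟩
  · intro i hi j hj heq
    rcases lt_trichotomy i j with h | h | h
    · exact absurd heq (key i j h hj)
    · exact h
    · exact absurd heq.symm (key j i h hi)
  · rcases Nat.lt_or_ge (i + 1) k with h | h
    · rw [Nat.mod_eq_of_lt h]
      exact hp i hi
    · obtain hik : i + 1 = k := by omega
      have := hp i hi
      rw [hik, hpk, ← h0] at this
      rwa [hik, Nat.mod_self]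

/-- If `x` is on no cycle, all paths through it are injective, so their lengths stay below `M`. A
longest one extends at neither end and is therefore a chain. -/
theorem exists_isComponent {f : PartialInjection X} {x : X} {M : ℕ}
    (hM : ∀ p, f.IsPath M p → (∃ t ≤ M, p t = x) → ¬ Set.InjOn p (Set.Iic M)) :
    ∃ b k S, f.IsComponent b k S ∧ x ∈ S := by
  classical
  by_cases hx : Relation.TransGen f.Graph x x
  · exact exists_isComponent_of_transGen hx
  have hex : ∃ n, ¬ ∃ p, f.IsPath n p ∧ ∃ t ≤ n, p t = x := by
    refine ⟨M, ?_⟩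
    rintro ⟨p, hp, t, ht, rfl⟩
    exact hM p hp ⟨t, ht, rfl⟩ (hp.injOn_of_not_transGen ht hx)
  have hspec := Nat.find_spec hex
  have hmin := fun m hm => Nat.find_min hex (m := m) hm
  obtain ⟨n, hn⟩ : ∃ n, Nat.find hex = n + 1 := by
    refine Nat.exists_eq_succ_of_ne_zero fun h0 => ?_
    rw [h0] at hspec
    exact hspec ⟨fun _ => x, fun i hi => absurd hi (by omega), 0, le_rfl, rfl⟩
  rw [hn] at hspec
  obtain ⟨p, hp, t, ht, rfl⟩ := not_not.1 (hmin n (by omega))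
  have hinj := hp.injOn_of_not_transGen ht hx
  refine ⟨false, n + 1, p '' Set.Iio (n + 1), ⟨by omega, p, hinj.mono fun i hi => ?_, rfl,
    fun y hy => hspec ?_, fun i hi => hp i (by omega), not_dom_iff.2 fun y hy => hspec ?_⟩,
    t, Nat.lt_succ_of_le ht, rfl⟩
  · exact Nat.le_of_lt_succ hi
  -- A preimage of the first vertex would lengthen the path; prepending it shifts `x` to position `t
  -- + 1`.
  · refine ⟨fun i => if i = 0 then y else p (i - 1), fun i hi => ?_, t + 1, by omega, by simp⟩
    rcases Nat.eq_zero_or_pos i with rfl | hpos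
    · simpa [Graph] using hy
    · have := hp (i - 1) (by omega)
      rw [Nat.sub_add_cancel hpos] at this
      simpa [hpos.ne'] using this
  · refine ⟨fun i => if i ≤ n then p i else y, fun i hi => ?_, t, by omega, by simp [ht]⟩
    rcases Nat.lt_succ_iff_lt_or_eq.1 hi with h | rfl
    · simpa [h.le, Nat.succ_le_of_lt h] using hp i h
    · simpa using hy

theorem IsPath.mem_iter {f : PartialInjection X} {n : ℕ} {p : ℕ → X} (hp : f.IsPath n p)
    {i d : ℕ} (h : i + d ≤ n) : p (i + d) ∈ f.iter d (p i) := by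
  induction d with
  | zero => exact Part.mem_some _
  | succ d ih => exact Part.mem_bind (ih (by omega)) (hp (i + d) (by omega))

/-- A path through `x` stays in its orbit, which cannot hold one vertex more than its cardinality.
-/
theorem exists_isComponent_of_finite_orbit {f : PartialInjection X} {x : X}
    (h : (f.orbit x).Finite) : ∃ b k S, f.IsComponent b k S ∧ x ∈ S := by
  refine exists_isComponent (M := (f.orbit x).ncard) ?_
  rintro p hp ⟨t, ht, rfl⟩ hinj
  have hsub : p '' Set.Iic (f.orbit (p t)).ncard ⊆ f.orbit (p t) := by
    rintro _ ⟨i, hi, rfl⟩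
    rcases Nat.le_total t i with hti | hti
    · obtain ⟨d, rfl⟩ := Nat.exists_eq_add_of_le hti
      exact ⟨d, Or.inl (hp.mem_iter hi)⟩
    · obtain ⟨d, hd⟩ := Nat.exists_eq_add_of_le hti
      refine ⟨d, Or.inr ?_⟩
      rw [hd]
      exact hp.mem_iter (by omega)
  have hle := Set.ncard_le_ncard hsub h
  rw [hinj.ncard_image] at hle
  simp [Set.ncard_eq_toFinset_card'] at hle

theorem IsPath.not_injOn_of_isComponent_le {f : PartialInjection X} {M : ℕ}
    (h : ∀ x, ∃ b, ∃ k ≤ M, ∃ S, f.IsComponent b k S ∧ x ∈ S) {p : ℕ → X}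
    (hp : f.IsPath M p) : ¬ Set.InjOn p (Set.Iic M) := by
  intro hinj
  obtain ⟨b, k, hk, S, hS, h0⟩ := h (p 0)
  have hmem : ∀ i ≤ M, p i ∈ S := by
    intro i
    induction i with
    | zero => exact fun _ => h0
    | succ i ih => exact fun hi => hS.mem_of_graph (ih (by omega)) (hp i hi)
  have hsub : p '' Set.Iic M ⊆ S := by
    rintro _ ⟨i, hi, rfl⟩
    exact hmem i hi
  have hle := Set.ncard_le_ncard hsub hS.finite
  rw [hinj.ncard_image, hS.ncard_eq] at hle
  simp [Set.ncard_eq_toFinset_card'] at hle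
  omega

theorem exists_isComponent_le_of_bounded {f : PartialInjection X}
    (hcyc : BoundedCharacter f.cycleCharacter) (hch : BoundedCharacter f.chainCharacter)
    (horb : ∀ a, (f.orbit a).Finite) :
    ∃ M, ∀ x, ∃ b, ∃ k ≤ M, ∃ S, f.IsComponent b k S ∧ x ∈ S := by
  obtain ⟨M₁, h₁⟩ := hcyc
  obtain ⟨M₂, h₂⟩ := hch
  refine ⟨max M₁ M₂, fun x => ?_⟩
  obtain ⟨b, k, S, hS, hx⟩ := exists_isComponent_of_finite_orbit (horb x)
  refine ⟨b, k, ?_, S, hS, hx⟩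
  cases b
  · exact le_max_of_le_right (h₂ (k, 1) ⟨hS.1, le_rfl, by
      simpa using Set.one_le_encard_iff_nonempty.2 ⟨S, hS⟩⟩)
  · exact le_max_of_le_left (h₁ (k, 1) ⟨hS.1, le_rfl, by
      simpa using Set.one_le_encard_iff_nonempty.2 ⟨S, hS⟩⟩)

/-! ### Normal forms -/

/-- The step relation on a disjoint union of cycles and chains, those of kind `p.1` and size
`p.2` being indexed by `T p`. -/
inductive NormalStep (T : Bool × ℕ → Type u) :
    ((p : Bool × ℕ) × (T p × Fin p.2)) → ((p : Bool × ℕ) × (T p × Fin p.2)) → Prop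
  | mk (p : Bool × ℕ) (S : T p) (i j : Fin p.2) (h : IsNext p.1 p.2 i j) :
      NormalStep T ⟨p, S, i⟩ ⟨p, S, j⟩

/-- Equivalent index types give isomorphic disjoint unions of cycles and chains. -/
def normalStepCongr {T T' : Bool × ℕ → Type u} (E : ∀ p, T p ≃ T' p) :
    NormalStep T ≃r NormalStep T' where
  toEquiv := Equiv.sigmaCongrRight fun p => (E p).prodCongr (Equiv.refl _)
  map_rel_iff' := by
    have key : ∀ {U U' : Bool × ℕ → Type u} (F : ∀ p, U p → U' p) {a b},
        NormalStep U a b →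
          NormalStep U' ⟨a.1, F _ a.2.1, a.2.2⟩ ⟨b.1, F _ b.2.1, b.2.2⟩ := by
      rintro U U' F a b ⟨p, S, i, j, h⟩
      exact .mk p _ i j h
    rintro ⟨p, S, i⟩ ⟨q, S', j⟩
    refine ⟨fun h => ?_, fun h => key (fun p => E p) h⟩
    have h' := key (fun p => (E p).symm) h
    change NormalStep T ⟨p, (E p).symm (E p S), i⟩ ⟨q, (E q).symm (E q S'), j⟩ at h'
    rwa [Equiv.symm_apply_apply, Equiv.symm_apply_apply] at h'

/-- Choose an enumeration of each component. Components that meet coincide, and the set determines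
size and kind, so position in a component is a bijective coordinate. -/
theorem nonempty_normalStep_iso {f : PartialInjection X}
    (h : ∀ x, ∃ b k S, f.IsComponent b k S ∧ x ∈ S) :
    Nonempty (NormalStep (fun p => {S // f.IsComponent p.1 p.2 S}) ≃r f.Graph) := by
  choose hk e hinj hS he using fun (p : Bool × ℕ) (S : {S // f.IsComponent p.1 p.2 S}) => S.2
  let φ : ((p : Bool × ℕ) × ({S // f.IsComponent p.1 p.2 S} × Fin p.2)) → X :=
    fun a => e a.1 a.2.1 a.2.2
  have hmem : ∀ a, φ a ∈ a.2.1.1 := by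
    intro a
    rw [hS a.1 a.2.1]
    exact ⟨a.2.2, a.2.2.2, rfl⟩
  have hφ : Function.Bijective φ := by
    constructor
    · rintro ⟨⟨b, k⟩, ⟨S, hbk⟩, i⟩ ⟨⟨b', k'⟩, ⟨S', hbk'⟩, i'⟩ heq
      have h₁ := hmem ⟨⟨b, k⟩, ⟨S, hbk⟩, i⟩
      have h₂ := hmem ⟨⟨b', k'⟩, ⟨S', hbk'⟩, i'⟩
      rw [← heq] at h₂
      obtain rfl : S = S' := hbk.eq_of_mem hbk' h₁ h₂
      obtain rfl : k = k' := hbk.ncard_eq.symm.trans hbk'.ncard_eq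
      obtain rfl : b = b' := Bool.eq_iff_iff.2 (hbk.true_iff.trans hbk'.true_iff.symm)
      obtain rfl : i = i' := Fin.ext (hinj _ _ i.2 i'.2 heq)
      rfl
    · intro x
      obtain ⟨b, k, S, hbk, hx⟩ := h x
      have hSe : S = e (b, k) ⟨S, hbk⟩ '' Set.Iio k := hS (b, k) ⟨S, hbk⟩
      rw [hSe] at hx
      obtain ⟨i, hi, rfl⟩ := hx
      exact ⟨⟨(b, k), ⟨S, hbk⟩, ⟨i, hi⟩⟩, rfl⟩
  refine ⟨⟨Equiv.ofBijective φ hφ, ?_⟩⟩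
  rintro ⟨p, S, i⟩ b
  change f.Graph (e p S i) (φ b) ↔ _
  rw [(he p S).graph_iff i.2]
  constructor
  · rintro ⟨j, hj, hn, hb⟩
    obtain rfl : b = ⟨p, S, ⟨j, hj⟩⟩ := hφ.1 hb
    exact NormalStep.mk (T := fun p => {S // f.IsComponent p.1 p.2 S}) p S i ⟨j, hj⟩ hn
  · rintro ⟨_, _, _, j, hn⟩
    exact ⟨j, j.2, hn, rfl⟩

theorem nonempty_iso_of_encard_eq [Countable X] [Countable Y] {f : PartialInjection X}
    {g : PartialInjection Y} (hf : ∀ x, ∃ b k S, f.IsComponent b k S ∧ x ∈ S)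
    (hg : ∀ x, ∃ b k S, g.IsComponent b k S ∧ x ∈ S)
    (h : ∀ b k, Set.encard {S | f.IsComponent b k S} = Set.encard {S | g.IsComponent b k S}) :
    Nonempty (f.Graph ≃r g.Graph) := by
  -- `Set.encard` does not separate infinite cardinals, so countability is needed to turn equal
  -- counts into bijections.
  have hcount : ∀ {Z : Type u} [Countable Z] (f : PartialInjection Z) (p : Bool × ℕ),
      Cardinal.mk {S // f.IsComponent p.1 p.2 S} ≤ Cardinal.aleph0 := by
    intro Z _ f p
    have hc : {S | f.IsComponent p.1 p.2 S}.Countable :=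
      Set.Countable.mono (fun S hS => hS.finite) Set.Countable.ofPred_finite
    exact Cardinal.mk_le_aleph0_iff.2 hc.to_subtype
  have hE : ∀ p : Bool × ℕ,
      Nonempty ({S // f.IsComponent p.1 p.2 S} ≃ {S // g.IsComponent p.1 p.2 S}) := fun p =>
    Cardinal.eq.1 (Cardinal.toENat_injOn (hcount f p) (hcount g p) (h p.1 p.2))
  obtain ⟨φ⟩ := nonempty_normalStep_iso hf
  obtain ⟨ψ⟩ := nonempty_normalStep_iso hg
  exact ⟨(φ.symm.trans (normalStepCongr fun p => (hE p).some)).trans ψ⟩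

end PartialInjection

/-! ### Elements of cohesive powers -/

namespace CohesiveSeq

variable {A C : Set ℕ}

/-- The constant sequence. -/
def const (C : Set ℕ) (a : A) : CohesiveSeq A C where
  toFun _ := Part.some a
  partrec := (Computable.const (a : ℕ)).partrec
  mem_carrier i b hb := by
    rw [Part.mem_some_iff] at hb
    exact hb ▸ a.2
  almost_dom := AlmostSubset.of_subset fun _ _ => trivial

theorem toFun_injective : Function.Injective (CohesiveSeq.toFun : CohesiveSeq A C → ℕ →. ℕ) := by
  rintro ⟨f, _, _, _⟩ ⟨g, _, _, _⟩ h
  cases h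
  rfl

instance : Countable (CohesiveSeq A C) := by
  choose c hc using fun ψ : CohesiveSeq A C =>
    Nat.Partrec.Code.exists_code.1 (Partrec.nat_iff.1 ψ.partrec)
  refine Function.Injective.countable (f := c) fun ψ φ h => toFun_injective ?_
  rw [← hc ψ, ← hc φ, h]

/-- The set of agreement is c.e., so cohesiveness turns failure of almost everywhere agreement into
agreement almost nowhere on `C`. -/
theorem not_equal_iff (hC : IsCohesive C) {ψ φ : CohesiveSeq A C} (h : ¬ Equal ψ φ) :
    AlmostSubset C {i | ∃ a, a ∈ ψ.toFun i ∧ a ∈ φ.toFun i}ᶜ := by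
  refine (hC.almostSubset_or_compl ?_).resolve_left h
  -- This computation halts exactly where both values exist and agree.
  have hp : Partrec fun i => (ψ.toFun i).bind fun a => (φ.toFun i).bind fun b =>
      ((if a = b then some () else none : Option Unit) : Part Unit) := by
    refine ψ.partrec.bind (Partrec.bind (φ.partrec.comp Computable.fst) ?_)
    refine Computable.ofOption ?_
    refine Primrec.to_comp (Primrec.ite ?_ (Primrec.const _) (Primrec.const _))
    exact Primrec.eq.comp (Primrec.snd.comp Primrec.fst) Primrec.snd
  refine hp.dom_re.of_eq fun i => ?_
  simp only [Part.dom_iff_mem, Part.mem_bind_iff, Set.mem_ofPred_eq]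
  constructor
  · rintro ⟨u, a, ha, b, hb, hu⟩
    by_cases hab : a = b
    · exact ⟨a, ha, hab ▸ hb⟩
    · simp [hab] at hu
  · rintro ⟨a, ha, hb⟩
    exact ⟨(), a, ha, a, hb, by simp⟩

end CohesiveSeq

/-! ### Elements of the power without image or preimage -/

namespace PartialInjection

variable {A C : Set ℕ}

theorem mem_natFun {f : PartialInjection A} {a b : ℕ} :
    b ∈ f.natFun a ↔ ∃ (ha : a ∈ A) (hb : b ∈ A), f.Graph ⟨a, ha⟩ ⟨b, hb⟩ := by
  constructor
  · rintro ⟨⟨ha, hd⟩, rfl⟩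
    exact ⟨ha, Subtype.coe_prop _, hd, rfl⟩
  · rintro ⟨ha, hb, hd, h⟩
    exact ⟨⟨ha, hd⟩, congrArg Subtype.val h⟩

/-- Otherwise, by cohesiveness, composing `ψ` with the partial computable `f` would define an image
of `ψ` in the power. -/
theorem almostSubset_not_dom {f : PartialInjection A} (hf : f.IsComputable) (hC : IsCohesive C)
    {ψ : CohesiveSeq A C} (h : ∀ φ : CohesiveSeq A C, ¬ CohesiveSeq.Holds f.Graph ψ φ) :
    AlmostSubset C {i | ∃ a ∈ ψ.toFun i, ∃ b, b ∈ f.natFun a}ᶜ := by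
  have hp : Partrec fun i => (ψ.toFun i).bind f.natFun :=
    ψ.partrec.bind (hf.2.1.comp Computable.snd)
  have hdom : ∀ i, ((ψ.toFun i).bind f.natFun).Dom ↔
      ∃ a ∈ ψ.toFun i, ∃ b, b ∈ f.natFun a := fun i => by
    rw [Part.dom_iff_mem]
    refine ⟨fun ⟨b, h⟩ => ?_, fun ⟨a, ha, b, hb⟩ => ⟨b, Part.mem_bind ha hb⟩⟩
    obtain ⟨a, ha, hb⟩ := Part.mem_bind_iff.1 h
    exact ⟨a, ha, b, hb⟩
  refine (hC.almostSubset_or_compl (hp.dom_re.of_eq hdom)).resolve_left fun hW => ?_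
  refine h ⟨_, hp, fun i b hb => ?_, hW.mono fun i hi => (hdom i).2 hi⟩ (hW.mono ?_)
  · obtain ⟨a, -, hab⟩ := Part.mem_bind_iff.1 hb
    exact (mem_natFun.1 hab).2.1
  · rintro i ⟨a, ha, b, hb⟩
    obtain ⟨hA, hB, hG⟩ := mem_natFun.1 hb
    exact ⟨a, b, hA, hB, ha, Part.mem_bind ha hb, hG⟩

/-- Otherwise a preimage of `ψ` in the power could be computed by unbounded search, since the graph
is decidable. -/
theorem almostSubset_not_range {f : PartialInjection A} (hf : f.IsComputable)
    (hC : IsCohesive C) {ψ : CohesiveSeq A C}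
    (h : ∀ φ : CohesiveSeq A C, ¬ CohesiveSeq.Holds f.Graph φ ψ) :
    AlmostSubset C {i | ∃ b ∈ ψ.toFun i, ∃ a, b ∈ f.natFun a}ᶜ := by
  obtain ⟨c, hc, hcG⟩ := ComputablePred.computable_iff.1 hf.2.2
  have hcG : ∀ a b, c (a, b) = true ↔ b ∈ f.natFun a := fun a b => by
    rw [mem_natFun]
    exact (iff_of_eq (congrFun hcG (a, b))).symm
  -- Stage `a` of the search tests the single candidate `a`.
  let s : ℕ → ℕ → Option ℕ := fun b a => bif c (a, b) then some a else none
  have hs : ∀ {a b x}, x ∈ s b a ↔ x = a ∧ b ∈ f.natFun a := by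
    intro a b x
    rw [← hcG]
    cases hcab : c (a, b) <;> simp [s, hcab, eq_comm]
  have hsearch : Partrec fun b => Nat.rfindOpt (s b) := by
    refine Partrec.rfindOpt ?_
    refine Computable.cond (hc.comp (Computable.pair Computable.snd Computable.fst))
      (Computable.option_some.comp Computable.snd) (Computable.const none)
  have hp : Partrec fun i => (ψ.toFun i).bind fun b => Nat.rfindOpt (s b) :=
    ψ.partrec.bind (hsearch.comp Computable.snd)
  have hdom : ∀ i, ((ψ.toFun i).bind fun b => Nat.rfindOpt (s b)).Dom ↔
      ∃ b ∈ ψ.toFun i, ∃ a, b ∈ f.natFun a := by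
    intro i
    simp only [Part.bind_dom, Nat.rfindOpt_dom, hs]
    exact ⟨fun ⟨hb, a, _, _, ha⟩ => ⟨_, Part.get_mem hb, a, ha⟩, fun ⟨b, ⟨hd, hb⟩, a, ha⟩ =>
      ⟨hd, a, a, rfl, hb ▸ ha⟩⟩
  have hspec : ∀ {b a}, a ∈ Nat.rfindOpt (s b) → b ∈ f.natFun a := by
    intro b a ha
    obtain ⟨n, hn⟩ := Nat.rfindOpt_spec ha
    obtain ⟨rfl, h⟩ := hs.1 hn
    exact h
  refine (hC.almostSubset_or_compl (hp.dom_re.of_eq hdom)).resolve_left fun hW => ?_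
  refine h ⟨_, hp, fun i a ha => ?_, hW.mono fun i hi => (hdom i).2 hi⟩ (hW.mono ?_)
  · obtain ⟨b, -, hab⟩ := Part.mem_bind_iff.1 ha
    exact (mem_natFun.1 (hspec hab)).1
  · intro i hi
    obtain ⟨a, ha⟩ := Part.dom_iff_mem.1 ((hdom i).2 hi)
    obtain ⟨b, hb, hab⟩ := Part.mem_bind_iff.1 ha
    obtain ⟨hA, hB, hG⟩ := mem_natFun.1 (hspec hab)
    exact ⟨a, b, hA, hB, ha, hb, hG⟩

end PartialInjection

/-! ### The power as a partial injection structure -/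

namespace CohesivePower

open PartialInjection

variable {A C : Set ℕ}

instance : Countable (CohesivePower A C) :=
  inferInstanceAs (Countable (Quotient (CohesiveSeq.setoid A C)))

theorem rel_right_unique (f : PartialInjection A) (x y z : CohesivePower A C)
    (h : rel A C f.Graph x y) (h' : rel A C f.Graph x z) : y = z := by
  induction x using Quotient.ind with | _ ψ
  induction y using Quotient.ind with | _ φ
  induction z using Quotient.ind with | _ θ
  refine Quotient.sound (AlmostSubset.mono (AlmostSubset.inter h h') ?_)
  rintro i ⟨⟨a, b, ha, hb, h₁, h₂, h₃⟩, ⟨a', b', ha', hb', h₁', h₂', h₃'⟩⟩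
  obtain rfl := Part.mem_unique h₁ h₁'
  obtain rfl : b = b' := congrArg Subtype.val (h₃.right_unique h₃')
  exact ⟨b, h₂, h₂'⟩

theorem rel_left_unique (f : PartialInjection A) (x y z : CohesivePower A C)
    (h : rel A C f.Graph x z) (h' : rel A C f.Graph y z) : x = y := by
  induction x using Quotient.ind with | _ ψ
  induction y using Quotient.ind with | _ φ
  induction z using Quotient.ind with | _ θ
  refine Quotient.sound (AlmostSubset.mono (AlmostSubset.inter h h') ?_)
  rintro i ⟨⟨a, b, ha, hb, h₁, h₂, h₃⟩, ⟨a', b', ha', hb', h₁', h₂', h₃'⟩⟩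
  obtain rfl := Part.mem_unique h₂ h₂'
  obtain rfl : a = a' := congrArg Subtype.val (h₃.left_unique h₃')
  exact ⟨a, h₁, h₁'⟩

/-- The partial injection of the cohesive power. -/
noncomputable def partialInjection (C : Set ℕ) (f : PartialInjection A) :
    PartialInjection (CohesivePower A C) :=
  ofRel (rel A C f.Graph) (rel_left_unique f)

theorem graph_partialInjection (f : PartialInjection A) :
    (partialInjection C f).Graph = rel A C f.Graph :=
  graph_ofRel _ (rel_right_unique f) (rel_left_unique f)

/-- The canonical embedding of a structure in its cohesive power. -/
def const (C : Set ℕ) (a : A) : CohesivePower A C :=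
  Quotient.mk (CohesiveSeq.setoid A C) (CohesiveSeq.const C a)

theorem isLocalEmbedding_const (hC : C.Infinite) (f : PartialInjection A) (F : Set A) :
    IsLocalEmbedding f (partialInjection C f) (const C) F where
  injOn a _ b _ h := by
    obtain ⟨i, -, c, hc, hc'⟩ := AlmostSubset.exists_mem hC (Quotient.exact h)
    exact Subtype.ext (((Part.mem_some_iff.1 hc).symm).trans (Part.mem_some_iff.1 hc'))
  map_graph a _ b _ h := by
    rw [graph_partialInjection]
    exact AlmostSubset.of_subset fun i _ =>
      ⟨a, b, a.2, b.2, Part.mem_some _, Part.mem_some _, h⟩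
  map_not_range a _ h y := by
    rw [graph_partialInjection]
    induction y using Quotient.ind with | _ φ
    intro hy
    obtain ⟨i, -, c, d, hc, hd, -, hd', hG⟩ := AlmostSubset.exists_mem hC hy
    obtain rfl : d = a := Part.mem_some_iff.1 hd'
    exact h _ hG
  map_not_dom a _ h y := by
    rw [graph_partialInjection]
    induction y using Quotient.ind with | _ φ
    intro hy
    obtain ⟨i, -, c, d, hc, hd, hc', -, hG⟩ := AlmostSubset.exists_mem hC hy
    obtain rfl : c = a := Part.mem_some_iff.1 hc'
    exact h _ hG

/-- Finite parts of the cohesive power embed locally in the structure, by evaluation at a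
suitable element of the cohesive set. -/
theorem exists_isLocalEmbedding {f : PartialInjection A} (hf : f.IsComputable)
    (hC : IsCohesive C) {F : Set (CohesivePower A C)} (hF : F.Finite) :
    ∃ e : CohesivePower A C → A, IsLocalEmbedding (partialInjection C f) f e F := by
  classical
  let r : CohesivePower A C → CohesiveSeq A C := Quotient.out
  have hr : ∀ x, Quotient.mk (CohesiveSeq.setoid A C) (r x) = x := fun x => Quotient.out_eq x
  have hrel : ∀ x y, (partialInjection C f).Graph x y ↔
      CohesiveSeq.Holds f.Graph (r x) (r y) := by
    intro x y
    rw [graph_partialInjection]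
    conv_lhs => rw [← hr x, ← hr y]
    rfl
  have hrel_left : ∀ x φ, CohesiveSeq.Holds f.Graph (r x) φ →
      ∃ y, (partialInjection C f).Graph x y := by
    intro x φ h
    refine ⟨Quotient.mk _ φ, ?_⟩
    rw [graph_partialInjection, ← hr x]
    exact h
  have hrel_right : ∀ x φ, CohesiveSeq.Holds f.Graph φ (r x) →
      ∃ y, (partialInjection C f).Graph y x := by
    intro x φ h
    refine ⟨Quotient.mk _ φ, ?_⟩
    rw [graph_partialInjection, ← hr x]
    exact h
  have hdom := AlmostSubset.forall_mem_finite hF fun x _ => (r x).almost_dom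
  have hran := AlmostSubset.forall_mem_finite
    (hF.subset (Set.sep_subset F fun x => ∀ y, ¬ (partialInjection C f).Graph y x))
    fun x hx => almostSubset_not_range hf hC (ψ := r x) fun φ hφ =>
      (hrel_right x φ hφ).elim hx.2
  have hndom := AlmostSubset.forall_mem_finite
    (hF.subset (Set.sep_subset F fun x => ∀ y, ¬ (partialInjection C f).Graph x y))
    fun x hx => almostSubset_not_dom hf hC (ψ := r x) fun φ hφ =>
      (hrel_left x φ hφ).elim hx.2
  have hne := AlmostSubset.forall_mem_finite
    ((hF.prod hF).subset (Set.sep_subset (F ×ˢ F) fun q => q.1 ≠ q.2))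
    fun q hq => CohesiveSeq.not_equal_iff hC (ψ := r q.1) (φ := r q.2) fun h =>
      hq.2 (by rw [← hr q.1, ← hr q.2]; exact Quotient.sound h)
  have hgr := AlmostSubset.forall_mem_finite
    ((hF.prod hF).subset
      (Set.sep_subset (F ×ˢ F) fun q => (partialInjection C f).Graph q.1 q.2))
    fun q hq => (hrel q.1 q.2).1 hq.2
  obtain ⟨i, -, hidom, hiran, hindom, hine, higr⟩ := AlmostSubset.exists_mem hC.1
    (hdom.inter (hran.inter (hndom.inter (hne.inter hgr))))
  -- The map `e` must be total, so it needs an arbitrary value outside `F`; any element of the power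
  -- witnesses that `A` is nonempty.
  have hA : CohesivePower A C → Nonempty A := fun x => by
    obtain ⟨j, -, hj⟩ := AlmostSubset.exists_mem hC.1 (r x).almost_dom
    exact ⟨⟨_, (r x).mem_carrier j _ (Part.get_mem hj)⟩⟩
  have he : ∀ x, ∃ a : A, x ∈ F → (a : ℕ) ∈ (r x).toFun i := by
    intro x
    by_cases hx : x ∈ F
    · have hd := Part.get_mem (hidom x hx)
      exact ⟨⟨_, (r x).mem_carrier i _ hd⟩, fun _ => hd⟩
    · exact ⟨(hA x).some, fun h => absurd h hx⟩
  choose e he using he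
  refine ⟨e, fun x hx y hy hxy => ?_, fun x hx y hy h => ?_, fun x hx h y hy => ?_,
    fun x hx h y hy => ?_⟩
  · by_contra hne'
    exact hine (x, y) ⟨⟨hx, hy⟩, hne'⟩ ⟨e x, he x hx, hxy ▸ he y hy⟩
  · obtain ⟨a, b, ha, hb, ha', hb', hG⟩ := higr (x, y) ⟨⟨hx, hy⟩, h⟩
    have h₁ : e x = ⟨a, ha⟩ := Subtype.ext (Part.mem_unique (he x hx) ha')
    have h₂ : e y = ⟨b, hb⟩ := Subtype.ext (Part.mem_unique (he y hy) hb')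
    rwa [h₁, h₂]
  · exact hiran x ⟨hx, h⟩ ⟨e x, he x hx, y, mem_natFun.2 ⟨y.2, (e x).2, hy⟩⟩
  · exact hindom x ⟨hx, h⟩ ⟨e x, he x hx, y, mem_natFun.2 ⟨(e x).2, y.2, hy⟩⟩

theorem encard_isComponent_eq {f : PartialInjection A} (hf : f.IsComputable)
    (hC : IsCohesive C) (b : Bool) (k : ℕ) :
    Set.encard {S | f.IsComponent b k S} =
      Set.encard {S | (partialInjection C f).IsComponent b k S} :=
  le_antisymm (le_encard_isComponent (fun F _ => ⟨_, isLocalEmbedding_const hC.1 f F⟩) b k)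
    (le_encard_isComponent (fun _ hF => exists_isLocalEmbedding hf hC hF) b k)

end CohesivePower

open PartialInjection CohesivePower in
theorem mainTheorem9 (A : Set ℕ) (f : PartialInjection A) (hf : f.IsComputable)
    (C : Set ℕ) (hC : IsCohesive C) :
    (∃ g : PartialInjection (CohesivePower A C),
      g.Graph = CohesivePower.rel A C f.Graph ∧
      g.cycleCharacter = f.cycleCharacter ∧
      g.chainCharacter = f.chainCharacter) ∧
    (BoundedCharacter f.cycleCharacter → BoundedCharacter f.chainCharacter →
      (∀ a : A, (f.orbit a).Finite) →
      Nonempty (f.Graph ≃r CohesivePower.rel A C f.Graph)) := by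
  have hcard := encard_isComponent_eq hf hC
  refine ⟨⟨partialInjection C f, graph_partialInjection f, (characters_eq hcard).1.symm,
    (characters_eq hcard).2.symm⟩, fun hcyc hch horb => ?_⟩
  obtain ⟨M, hM⟩ := exists_isComponent_le_of_bounded hcyc hch horb
  rw [← graph_partialInjection f]
  refine nonempty_iso_of_encard_eq
    (fun x => exists_isComponent_of_finite_orbit (horb x)) (fun x => ?_) hcard
  refine exists_isComponent (M := M) fun p hp _ hinj => ?_
  -- Evaluate the `M + 1` distinct vertices in `A`: their images form an injective path longer than
  -- any component allows.
  obtain ⟨e, he⟩ := exists_isLocalEmbedding hf hC ((Set.finite_Iic M).image p)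
  refine IsPath.not_injOn_of_isComponent_le hM (p := e ∘ p) (fun i hi => ?_)
    (he.injOn.comp hinj fun i hi => ⟨i, hi, rfl⟩)
  exact he.map_graph _ ⟨i, hi.le, rfl⟩ _ ⟨i + 1, hi, rfl⟩ (hp i hi)
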